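/- **Effective spaces.** Let $E$ be a topological space and let $(O_n)_{n\in\mathbb N}$ enumerate (not necessarily injectively) a topological basis $\mathcal B$ of $E$. An *approximation relation* on $\mathcal B$ is a binary relation $\ll$ on $\mathcal B$ such that for all $U,V,T\in\mathcal B$: (1) if $U\ll V$ then $V\subseteq U$; (2) if $U\subseteq T$ and $U\ll V$ then $T\ll V$; (3) for every $x\in U$ there is $W\in\mathcal B$ with $x\in W$ and $U\ll W$; (4) if $U_i\in\mathcal B$ and $U_i\ll U_{i+1}$ for all $i\in\mathbb N$, then $\bigcap_i U_i\neq\emptyset$. The triple $(E,(O_n)_n,\ll)$ is an *effective approximation space* if $\ll$ is an approximation relation on $\mathcal B$ and $\{(i,j)\mid O_i\ll O_j\}$ is computably enumerable. **Effective classes.** A sequence $(X_n)_{n\in\mathbb N}$ of subsets of $E$ is *uniformly* $\Sigma^0_1$ if there is a computably enumerable set $W\subseteq\mathbb N^2$ with $X_n=\bigcup_{i:(n,i)\in W}O_i$ for all $n$, and *uniformly* $\Pi^0_1$ if $(E\setminus X_n)_n$ is uniformly $\Sigma^0_1$. $G_\delta(E)$ is the class of sets $\bigcap_n X_n$ with $(X_n)_n$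 uniformly $\Sigma^0_1$, and $F_\sigma(E)$ is the class of sets $\bigcup_n X_n$ with $(X_n)_n$ uniformly $\Pi^0_1$. $\Sigma^0_2(E)$ is the class of sets $\bigcup_n (U_n\setminus V_n)$ with $(U_n)_n$, $(V_n)_n$ uniformly $\Sigma^0_1$; $\Pi^0_2(E)$ is the class of complements of sets in $\Sigma^0_2(E)$, and $\Delta^0_2(E)=\Sigma^0_2(E)\cap\Pi^0_2(E)$. **Effective difference classes.** $\omega_1^{CK}$ is the least ordinal that is not the order type of a computable well-order of a subset of $\mathbb N$. Every ordinal is $\lambda+n$ with $\lambda$ zero or limit and $n\in\mathbb N$, and its parity is that of $n$. For $1\le\alpha<\omega_1^{CK}$, a set $X\subseteq E$ is in $D_\alpha(E)$ if there are a computable well-order $\preceq$ of type $\alpha$ on $\mathbb N$ or on a finite initial segment of $\mathbb N$, with isomorphism $\varphi$ onto $\alpha$, for which the set $P$ of all $n\in\mathrm{dom}(\preceq)$ such that $\varphi(n)$ and $\alpha$ have different parities is computable, and a uniformly $\Sigma^0_1$ sequence $(A_n)_n$, such that $$X=\bigcup_{p\in P}\Bigl(A_p\setminus\bigcup_{q\in\mathrm{dom}(\preceq):\,\varphi(q)<\varphi(p)}A_q\Bigr).$$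 **Theorem.** In every effective approximation space $(E,(O_n)_n,\ll)$, $$F_\sigma(E)\cap G_\delta(E)\ \subseteq\ \bigcup_{1\le\alpha<\omega_1^{CK}}D_\alpha(E)\ \subseteq\ \Delta^0_2(E).$$ In particular, if $F_\sigma(E)\cap G_\delta(E)=\Delta^0_2(E)$, then $\bigcup_{1\le\alpha<\omega_1^{CK}}D_\alpha(E)=\Delta^0_2(E)$. -/

import Mathlib

open Set

namespace EffHausdorff

/-! ### Approximation spaces -/

section Spaces

variable {E : Type*} [TopologicalSpace E]

/-- `ll` (written `≪` on paper) is an approximation relation on the topological basis `B`.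
Only the values of `ll` on members of `B` matter. -/
structure IsApproximationRelation (B : Set (Set E)) (ll : Set E → Set E → Prop) : Prop where
  isBasis : TopologicalSpace.IsTopologicalBasis B
  subset_of_ll : ∀ U ∈ B, ∀ V ∈ B, ll U V → V ⊆ U
  ll_of_subset : ∀ U ∈ B, ∀ V ∈ B, ∀ T ∈ B, U ⊆ T → ll U V → ll T V
  exists_ll : ∀ U ∈ B, ∀ x ∈ U, ∃ W ∈ B, x ∈ W ∧ ll U W
  inter_nonempty : ∀ U : ℕ → Set E, (∀ i, U i ∈ B) → (∀ i, ll (U i) (U (i + 1))) →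
    (⋂ i, U i).Nonempty

/-- `(E, (O n), ≪)` is an effective approximation space: `O` enumerates (not necessarily
injectively) a topological basis, `≪` is an approximation relation on that basis, and
`{(i, j) | O i ≪ O j}` is computably enumerable. -/
structure IsEffectiveApproximationSpace (O : ℕ → Set E) (ll : Set E → Set E → Prop) : Prop where
  isApprox : IsApproximationRelation (range O) ll
  ce : REPred fun p : ℕ × ℕ => ll (O p.1) (O p.2)

end Spaces

/-! ### Effective Borel classes of low level, relative to an enumeration `O` of a basis -/

section Borel

variable {E : Type*}

/-- The sequence `(X n)` is uniformly `Σ⁰₁`: there is a computably enumerable set `W` of pairs with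
`X n = ⋃ {O i | (n, i) ∈ W}` for all `n`. -/
def UniformlySigma1 (O : ℕ → Set E) (X : ℕ → Set E) : Prop :=
  ∃ W : Set (ℕ × ℕ), (REPred fun p : ℕ × ℕ => p ∈ W) ∧
    ∀ n, X n = ⋃ i ∈ {i : ℕ | (n, i) ∈ W}, O i

/-- The sequence `(X n)` is uniformly `Π⁰₁`. -/
def UniformlyPi1 (O : ℕ → Set E) (X : ℕ → Set E) : Prop :=
  UniformlySigma1 O fun n => (X n)ᶜ

/-- The effective class `G_δ`: intersections of uniformly `Σ⁰₁` sequences. -/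
def EffGdelta (O : ℕ → Set E) : Set (Set E) :=
  {X | ∃ U : ℕ → Set E, UniformlySigma1 O U ∧ X = ⋂ n, U n}

/-- The effective class `F_σ`: unions of uniformly `Π⁰₁` sequences. -/
def EffFsigma (O : ℕ → Set E) : Set (Set E) :=
  {X | ∃ C : ℕ → Set E, UniformlyPi1 O C ∧ X = ⋃ n, C n}

/-- The effective class `Σ⁰₂`: sets `⋃ n, U n \ V n` where `(U n)` and `(V n)` are
uniformly `Σ⁰₁`. -/
def EffSigma2 (O : ℕ → Set E) : Set (Set E) :=
  {X | ∃ U V : ℕ → Set E, UniformlySigma1 O U ∧ UniformlySigma1 O V ∧ X = ⋃ n, U n \ V n}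

/-- The effective class `Π⁰₂`: complements of effective `Σ⁰₂` sets. -/
def EffPi2 (O : ℕ → Set E) : Set (Set E) :=
  {X | Xᶜ ∈ EffSigma2 O}

/-- The effective class `Δ⁰₂ = Σ⁰₂ ∩ Π⁰₂`. -/
def EffDelta2 (O : ℕ → Set E) : Set (Set E) :=
  EffSigma2 O ∩ EffPi2 O

end Borel

/-! ### Computable ordinals -/

/-- The binary relation `r` is (the non-strict part of) a well-order with domain `D` and order type
`α`, and `φ` is its isomorphism onto the ordinal `α` (identified with the set of the ordinals
below `α`). -/
structure IsWellOrderRank (D : Set ℕ) (r : ℕ → ℕ → Prop) (α : Ordinal.{0})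
    (φ : ℕ → Ordinal.{0}) : Prop where
  dom : ∀ m n, r m n → m ∈ D ∧ n ∈ D
  bijOn : BijOn φ D (Iio α)
  le_iff : ∀ m ∈ D, ∀ n ∈ D, (r m n ↔ φ m ≤ φ n)

/-- `α` is a computable ordinal: the order type of a computable well-order of a
subset of `ℕ`. (The subset is then computable too, being `{n | r n n}`.) -/
def IsComputableOrdinal (α : Ordinal.{0}) : Prop :=
  ∃ (D : Set ℕ) (r : ℕ → ℕ → Prop) (φ : ℕ → Ordinal.{0}),
    (ComputablePred fun p : ℕ × ℕ => r p.1 p.2) ∧ IsWellOrderRank D r α φ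

/-- The Church–Kleene ordinal `ω₁^CK`: the least ordinal that is not computable. -/
noncomputable def omega1CK : Ordinal.{0} :=
  sInf {α : Ordinal.{0} | ¬ IsComputableOrdinal α}

/-- Two ordinals have the same parity. The limit ordinals and `0` are even. -/
def SameParity (α β : Ordinal.{0}) : Prop :=
  α % 2 = β % 2

/-! ### The effective difference hierarchy -/

section Hausdorff

variable {E : Type*}

/-- The effective class `D_α(E) = D_α(Σ⁰₁(E))`. A code of `X` consists of a computable well-order
`r` of type `α` on `ℕ` or on a finite initial segment of `ℕ`, the computable set `P` of those `n`
in its domain whose rank `φ n` has parity different from that of `α`, and a uniformly `Σ⁰₁`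
sequence `(A n)`, such that `X` is the union over `p ∈ P` of
`A p \ ⋃ {A q | φ q < φ p}`. -/
def EffD (O : ℕ → Set E) (α : Ordinal.{0}) : Set (Set E) :=
  {X | ∃ (D : Set ℕ) (r : ℕ → ℕ → Prop) (φ : ℕ → Ordinal.{0}) (P : Set ℕ) (A : ℕ → Set E),
    (D = univ ∨ ∃ k : ℕ, D = Iio k) ∧
    IsWellOrderRank D r α φ ∧
    (ComputablePred fun p : ℕ × ℕ => r p.1 p.2) ∧
    P = {n | n ∈ D ∧ ¬ SameParity (φ n) α} ∧
    (ComputablePred fun n : ℕ => n ∈ P) ∧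
    UniformlySigma1 O A ∧
    X = ⋃ p ∈ P, (A p \ ⋃ q ∈ {q | q ∈ D ∧ φ q < φ p}, A q)}

/-- The union of the effective classes `D_α(E)` over `1 ≤ α < ω₁^CK`. -/
def EffDUnion (O : ℕ → Set E) : Set (Set E) :=
  ⋃ α ∈ {α : Ordinal.{0} | 1 ≤ α ∧ α < omega1CK}, EffD O α

end Hausdorff

end EffHausdorff

namespace EffHausdorff

/-! ### Computably enumerable predicates as projections -/

section Projection

variable {α β : Type*} [Primcodable α] [Primcodable β]

/-! First inclusion: interleave the open sets whose intersection is `X` with those whose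
intersection is the complement of `X`. The result is a sequence `G` with empty intersection; points
of `X` lie in every even term and other points in every odd term. Consider the tree of finite
`≪`-chains of basic open sets whose member at position `n + 1` lies inside `G n`. Axiom (4) would
place a point of `⋂ n, G n` on an infinite branch, so there is none, and the Kleene–Brouwer order
well-orders the tree (`wellFounded_of_no_branch`). Storing enumeration witnesses in the nodes makes
tree and order primitive recursive. For a point `x`, take the least nonempty node whose last set
contains `x`. If `x` were in the next required `G n`, axioms (2) and (3) would extend the node to a
smaller one still containing `x`. Hence `x ∉ G n`, and the parity of `n` decides whether `x ∈ X`.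
Multiplying the order type by `ω` leaves room to place each node at a rank of the parity its length
demands. Second inclusion: the least-ranked `A n` containing `x` decides membership in `X`
(`mem_iUnion_diff_iff`), which gives `Σ⁰₂` forms of both `X` and its complement. -/

/-- The witness `s` is a step bound for a bounded evaluation of a program that semi-decides `p`. -/
theorem _root_.REPred.exists_primrecRel {p : α → Prop} (hp : REPred p) :
    ∃ q : α → ℕ → Prop, PrimrecRel q ∧ ∀ a, p a ↔ ∃ s, q a s := by
  obtain ⟨c, hc⟩ := Nat.Partrec.Code.exists_code.1 hp
  refine ⟨fun a s => (Nat.Partrec.Code.evaln s c (Encodable.encode a)).isSome = true,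
    ⟨inferInstance, ?_⟩, fun a => ?_⟩
  · have : Primrec fun x : α × ℕ =>
        (Nat.Partrec.Code.evaln x.2 c (Encodable.encode x.1)).isSome :=
      Primrec.option_isSome.comp (Nat.Partrec.Code.primrec_evaln.comp
        (Primrec.pair (Primrec.pair Primrec.snd (Primrec.const c))
          (Primrec.encode.comp Primrec.fst)))
    exact this.of_eq fun x => by simp
  · have h : p a ↔ (Nat.Partrec.Code.eval c (Encodable.encode a)).Dom := by
      rw [hc]; simp [Part.assert]
    rw [h, Part.dom_iff_mem]
    simp only [Nat.Partrec.Code.evaln_complete, Option.isSome_iff_exists, Option.mem_def]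
    exact exists_comm

theorem _root_.REPred.of_primrecRel {q : α → ℕ → Prop} (hq : PrimrecRel q) :
    REPred fun a => ∃ s, q a s := by
  classical
  have hq' : Computable₂ fun a n => decide (q a n) := hq.decide.to_comp
  refine (Partrec.rfind hq'.partrec₂).dom_re.of_eq fun a => ?_
  rw [Nat.rfind_dom]
  constructor
  · rintro ⟨n, h, -⟩
    exact ⟨n, by simpa using h⟩
  · rintro ⟨n, h⟩
    exact ⟨n, by simpa using h, fun _ => trivial⟩

theorem _root_.REPred.comp_computable {p : β → Prop} {f : α → β} (hp : REPred p)
    (hf : Computable f) : REPred fun a => p (f a) :=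
  Partrec.comp hp hf

theorem _root_.REPred.exists_nat {p : α → ℕ → Prop} (hp : REPred fun x : α × ℕ => p x.1 x.2) :
    REPred fun a => ∃ n, p a n := by
  obtain ⟨q, hq, hpq⟩ := hp.exists_primrecRel
  have : PrimrecRel fun (a : α) (s : ℕ) => q (a, s.unpair.1) s.unpair.2 :=
    hq.comp (Primrec.pair Primrec.fst (Primrec.fst.comp (Primrec.unpair.comp Primrec.snd)))
      (Primrec.snd.comp (Primrec.unpair.comp Primrec.snd))
  refine (REPred.of_primrecRel this).of_eq fun a => ?_
  constructor
  · rintro ⟨s, hs⟩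
    exact ⟨_, (hpq _).2 ⟨_, hs⟩⟩
  · rintro ⟨n, hn⟩
    obtain ⟨s, hs⟩ := (hpq (a, n)).1 hn
    exact ⟨Nat.pair n s, by simpa using hs⟩

theorem _root_.REPred.and {p q : α → Prop} (hp : REPred p) (hq : REPred q) :
    REPred fun a => p a ∧ q a := by
  obtain ⟨p', hp', hpp⟩ := hp.exists_primrecRel
  obtain ⟨q', hq', hqq⟩ := hq.exists_primrecRel
  have h1 : PrimrecPred fun x : (α × ℕ) × ℕ => p' x.1.1 x.1.2 ∧ q' x.1.1 x.2 :=
    (hp'.comp (Primrec.fst.comp Primrec.fst) (Primrec.snd.comp Primrec.fst)).and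
      (hq'.comp (Primrec.fst.comp Primrec.fst) Primrec.snd)
  refine (REPred.exists_nat (p := fun a n => ∃ m, p' a n ∧ q' a m) (REPred.exists_nat
    (p := fun (x : α × ℕ) m => p' x.1 x.2 ∧ q' x.1 m) h1.computablePred.to_re)).of_eq fun a => ?_
  simp [hpp, hqq]

theorem _root_.REPred.or {p q : α → Prop} (hp : REPred p) (hq : REPred q) :
    REPred fun a => p a ∨ q a := by
  obtain ⟨p', hp', hpp⟩ := hp.exists_primrecRel
  obtain ⟨q', hq', hqq⟩ := hq.exists_primrecRel
  refine (REPred.of_primrecRel (q := fun a n => p' a n ∨ q' a n) (PrimrecPred.or hp' hq')).of_eq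
    fun a => ?_
  rw [hpp, hqq, exists_or]

theorem _root_.PrimrecRel.bounded_exists {R : ℕ → β → Prop} (hR : PrimrecRel R) :
    PrimrecRel fun n y => ∃ x < n, R x y :=
  (hR.exists_mem_list.comp (Primrec.list_range.comp Primrec.fst) Primrec.snd).of_eq (by simp)

theorem _root_.PrimrecRel.bounded_forall {R : ℕ → β → Prop} (hR : PrimrecRel R) :
    PrimrecRel fun n y => ∀ x < n, R x y :=
  (hR.forall_mem_list.comp (Primrec.list_range.comp Primrec.fst) Primrec.snd).of_eq (by simp)

end Projection

/-! ### The Kleene–Brouwer order -/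

/-- The Kleene–Brouwer order on finite sequences: `s` is below `t` if `s` properly extends `t` or
is lexicographically smaller at the first difference. -/
def KleeneBrouwer : List ℕ → List ℕ → Prop
  | [], _ => False
  | _ :: _, [] => True
  | a :: s, b :: t => a < b ∨ a = b ∧ KleeneBrouwer s t

namespace KleeneBrouwer

theorem trichotomy : ∀ s t : List ℕ, KleeneBrouwer s t ∨ s = t ∨ KleeneBrouwer t s
  | [], [] => by simp
  | [], _ :: _ => by simp [KleeneBrouwer]
  | _ :: _, [] => by simp [KleeneBrouwer]
  | a :: s, b :: t => by
    have := trichotomy s t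
    rcases lt_trichotomy a b with h | rfl | h
    · simp [KleeneBrouwer, h]
    · simpa [KleeneBrouwer] using this
    · simp [KleeneBrouwer, h]

theorem append_singleton (s : List ℕ) (a : ℕ) : KleeneBrouwer (s ++ [a]) s := by
  induction s with
  | nil => simp [KleeneBrouwer]
  | cons b s ih => simp [KleeneBrouwer, ih]

/-- The recursion is unfolded into bounded quantifiers so that primitive recursiveness can be read
off: `i` is the first position where `s` goes on and `t` has ended or has a larger entry. The
default `0` of `getD` never affects the truth value. -/
theorem iff_exists (s t : List ℕ) : KleeneBrouwer s t ↔
    ∃ i < s.length, (∀ j < i, s.getD j 0 = t.getD j 0) ∧ i ≤ t.length ∧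
      (i = t.length ∨ s.getD i 0 < t.getD i 0) := by
  induction s generalizing t with
  | nil => simp [KleeneBrouwer]
  | cons a s ih =>
    cases t with
    | nil => simp [KleeneBrouwer]
    | cons b t =>
      simp only [KleeneBrouwer, ih]
      constructor
      · rintro (h | ⟨rfl, i, hi, h1, h2, h3⟩)
        · exact ⟨0, by simp [h]⟩
        · refine ⟨i + 1, by simpa using hi, ?_, by simpa using h2, by simpa using h3⟩
          rintro (_ | j) hj
          · simp
          · simpa using h1 j (by omega)
      · rintro ⟨_ | i, hi, h1, h2, h3⟩
        · left; simpa using h3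
        · refine Or.inr ⟨by simpa using h1 0 (by omega), i, by simpa using hi, fun j hj => ?_,
            by simpa using h2, by simpa using h3⟩
          simpa using h1 (j + 1) (by omega)

theorem primrecRel : PrimrecRel KleeneBrouwer := by
  have hget : ∀ {γ : Type} [Primcodable γ] {f : γ → List ℕ} {g : γ → ℕ}, Primrec f → Primrec g →
      Primrec fun c => (f c).getD (g c) 0 := fun hf hg => (Primrec.list_getD 0).comp hf hg
  have h1 : PrimrecRel fun (j : ℕ) (x : List ℕ × List ℕ) => x.1.getD j 0 = x.2.getD j 0 :=
    Primrec.eq.comp (hget (Primrec.fst.comp Primrec.snd) Primrec.fst)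
      (hget (Primrec.snd.comp Primrec.snd) Primrec.fst)
  have h1' : PrimrecPred fun y : ℕ × List ℕ × List ℕ =>
      ∀ j < y.1, y.2.1.getD j 0 = y.2.2.getD j 0 := h1.bounded_forall
  have h2 : PrimrecRel fun (i : ℕ) (x : List ℕ × List ℕ) =>
      (∀ j < i, x.1.getD j 0 = x.2.getD j 0) ∧ i ≤ x.2.length ∧
        (i = x.2.length ∨ x.1.getD i 0 < x.2.getD i 0) :=
    h1'.and ((Primrec.nat_le.comp Primrec.fst
      (Primrec.list_length.comp (Primrec.snd.comp Primrec.snd))).and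
      ((Primrec.eq.comp Primrec.fst
        (Primrec.list_length.comp (Primrec.snd.comp Primrec.snd))).or
      (Primrec.nat_lt.comp (hget (Primrec.fst.comp Primrec.snd) Primrec.fst)
        (hget (Primrec.snd.comp Primrec.snd) Primrec.fst))))
  have h3 := h2.bounded_exists.comp (Primrec.list_length.comp (Primrec.fst (α := List ℕ) (β := List ℕ)))
    (Primrec.id (α := List ℕ × List ℕ))
  exact h3.of_eq fun x => (iff_exists x.1 x.2).symm

/-- If the Kleene–Brouwer order is well-founded on the subtree above each `[a]`, then it is
well-founded on the whole tree. -/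
theorem wellFounded_of_subtrees {T : List ℕ → Prop}
    (h : ∀ a, WellFounded fun s t => T (a :: s) ∧ T (a :: t) ∧ KleeneBrouwer s t) :
    WellFounded fun s t => T s ∧ T t ∧ KleeneBrouwer s t := by
  have hcons : ∀ a s, Acc (fun s t => T s ∧ T t ∧ KleeneBrouwer s t) (a :: s) := by
    -- A predecessor of `a :: s` has a smaller head, or the same head and a smaller tail, so an
    -- outer induction on `a` and an inner one in its subtree suffice.
    intro a
    induction a using Nat.strong_induction_on with
    | _ a iha =>
      intro s
      induction s using (h a).induction with
      | _ s ihs =>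
        refine ⟨_, ?_⟩
        rintro (_ | ⟨b, t⟩) ⟨h1, h2, h3⟩
        · exact h3.elim
        · rcases h3 with h3 | ⟨rfl, h3⟩
          · exact iha b h3 t
          · exact ihs t ⟨h1, h2, h3⟩
  refine ⟨fun s => ?_⟩
  cases s with
  | cons a s => exact hcons a s
  | nil =>
    refine ⟨_, ?_⟩
    rintro (_ | ⟨b, t⟩) ⟨h1, h2, h3⟩
    · exact h3.elim
    · exact hcons b t

/-- The Kleene–Brouwer order is well-founded on a tree without infinite branches. -/
theorem wellFounded_of_no_branch {T : List ℕ → Prop} (hT : ∀ s t, T (s ++ t) → T s)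
    (hbranch : ∀ f : ℕ → ℕ, ∃ n, ¬ T ((List.range n).map f)) :
    WellFounded fun s t => T s ∧ T t ∧ KleeneBrouwer s t := by
  by_contra hwf
  -- Ill-foundedness above `u` passes to some child of `u`. Iterating from the root traces a branch,
  -- which leaves `T` at some point; there the relation is empty, hence well-founded.
  let Bad : List ℕ → Prop := fun u =>
    ¬ WellFounded fun s t => T (u ++ s) ∧ T (u ++ t) ∧ KleeneBrouwer s t
  have step : ∀ u, Bad u → ∃ a, Bad (u ++ [a]) := by
    intro u hu
    by_contra! hc
    refine hu (wellFounded_of_subtrees (T := fun s => T (u ++ s)) fun a => ?_)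
    simpa [Bad] using hc a
  choose! g hg using step
  let c : ℕ → List ℕ := fun n => Nat.rec [] (fun _ u => u ++ [g u]) n
  have hc : ∀ n, Bad (c n) := by
    intro n
    induction n with
    | zero => simpa [Bad, c] using hwf
    | succ n ih => exact hg _ ih
  have hmap : ∀ n, c n = (List.range n).map fun k => g (c k) := by
    intro n
    induction n with
    | zero => rfl
    | succ n ih =>
      rw [List.range_succ, List.map_append, ← ih]
      rfl
  obtain ⟨n, hn⟩ := hbranch fun k => g (c k)
  rw [← hmap] at hn
  exact hc n ⟨fun s => ⟨_, fun t ht => (hn (hT _ _ ht.1)).elim⟩⟩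

end KleeneBrouwer

/-! ### Computable well-orders -/

section Ordinals

open Ordinal

theorem omega0_mul_add_natCast_le_iff (a b : Ordinal.{0}) (k l : ℕ) :
    ω * a + k ≤ ω * b + l ↔ a < b ∨ a = b ∧ k ≤ l := by
  have key : ∀ {a b : Ordinal.{0}} (k l : ℕ), a < b → ω * a + k < ω * b + l := by
    intro a b k l h
    calc ω * a + k < ω * a + ω := by
          simp
      _ = ω * (a + 1) := (mul_add_one ω a).symm
      _ ≤ ω * b := mul_le_mul_right (Order.add_one_le_of_lt h) _
      _ ≤ ω * b + l := le_self_add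
  rcases lt_trichotomy a b with h | rfl | h
  · simp [h, (key k l h).le]
  · simp
  · simp [h.not_gt, h.ne', key l k h]

theorem omega0_mul_mod_two (a : Ordinal.{0}) : ω * a % 2 = 0 := by
  -- Absorbing a left factor `2` into `ω` exhibits `ω * a` as a left multiple of `2`.
  have h : (ω : Ordinal.{0}) = 2 * ω := by
    have := natCast_mul_omega0 (n := 2) (by norm_num)
    exact_mod_cast this.symm
  rw [h, mul_assoc]
  exact mul_mod 2 _

theorem omega0_mul_add_natCast_mod_two (a : Ordinal.{0}) (k : ℕ) :
    (ω * a + k) % 2 = ((k % 2 : ℕ) : Ordinal.{0}) := by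
  have h : (ω : Ordinal.{0}) = 2 * ω := by
    have := natCast_mul_omega0 (n := 2) (by norm_num)
    exact_mod_cast this.symm
  rw [h, mul_assoc, mul_add_mod_self]
  norm_cast

/-- The rank function of the product of `ω` and a well-order `r` of `ℕ`, where the copy of `ω` in
place of `a` consists of the codes of the pairs `(a, k)`. -/
noncomputable def omegaRank (r : ℕ → ℕ → Prop) [IsWellOrder ℕ r] (n : ℕ) : Ordinal.{0} :=
  ω * typein r n.unpair.1 + n.unpair.2

theorem isWellOrderRank_omegaRank (r : ℕ → ℕ → Prop) [IsWellOrder ℕ r] :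
    IsWellOrderRank univ
      (fun m n => r m.unpair.1 n.unpair.1 ∨ m.unpair.1 = n.unpair.1 ∧ m.unpair.2 ≤ n.unpair.2)
      (ω * type r) (omegaRank r) where
  dom _ _ _ := ⟨mem_univ _, mem_univ _⟩
  bijOn := by
    refine ⟨fun n _ => ?_, fun m _ n _ h => ?_, fun o ho => ?_⟩
    · exact lt_mul_iff.2 ⟨_, typein_lt_type r _, _, natCast_lt_omega0 _, rfl⟩
    · have h1 := (omega0_mul_add_natCast_le_iff _ _ _ _).1 h.le
      have h2 := (omega0_mul_add_natCast_le_iff _ _ _ _).1 h.ge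
      simp only [typein_lt_typein, typein_inj] at h1 h2
      have h3 : m.unpair = n.unpair := by
        rcases h1 with h1 | ⟨h1, h1'⟩
        · rcases h2 with h2 | ⟨h2, -⟩
          · exact (asymm_of r h1 h2).elim
          · exact (irrefl_of r _ (h2 ▸ h1)).elim
        · rcases h2 with h2 | ⟨-, h2'⟩
          · exact (irrefl_of r _ (h1 ▸ h2)).elim
          · exact Prod.ext h1 (le_antisymm h1' h2')
      rw [← Nat.pair_unpair m, h3, Nat.pair_unpair]
    · obtain ⟨q, hq, c, hc, rfl⟩ := lt_mul_iff.1 ho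
      obtain ⟨a, rfl⟩ := typein_surj r hq
      obtain ⟨k, rfl⟩ := lt_omega0.1 hc
      exact ⟨Nat.pair a k, mem_univ _, by simp [omegaRank]⟩
  le_iff m _ n _ := by
    simp only [omegaRank, omega0_mul_add_natCast_le_iff, typein_lt_typein, typein_inj]

theorem IsWellOrderRank.lt_iff {D : Set ℕ} {r : ℕ → ℕ → Prop} {α : Ordinal.{0}}
    {φ : ℕ → Ordinal.{0}} (h : IsWellOrderRank D r α φ) {m n : ℕ} (hn : n ∈ D) :
    (m ∈ D ∧ φ m < φ n) ↔ r m n ∧ ¬ r n m := by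
  constructor
  · rintro ⟨hm, hlt⟩
    exact ⟨(h.le_iff m hm n hn).2 hlt.le, fun hc => ((h.le_iff n hn m hm).1 hc).not_gt hlt⟩
  · rintro ⟨h1, h2⟩
    have hm := (h.dom _ _ h1).1
    exact ⟨hm, lt_of_not_ge fun hc => h2 ((h.le_iff n hn m hm).2 hc)⟩

theorem IsComputableOrdinal.of_le {α β : Ordinal.{0}} (h : IsComputableOrdinal α) (hβ : β ≤ α) :
    IsComputableOrdinal β := by
  rcases hβ.eq_or_lt with rfl | hβ
  · exact h
  obtain ⟨D, r, φ, hr, hφ⟩ := h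
  obtain ⟨b, hb, rfl⟩ := hφ.bijOn.surjOn hβ
  -- The initial segment below `b`, expressed through `r` alone to stay computable; only `n` has to
  -- be bounded, since `m` is below `n`.
  refine ⟨{n | n ∈ D ∧ φ n < φ b}, fun m n => r m n ∧ r n b ∧ ¬ r b n, φ, ?_, ?_⟩
  · refine ComputablePred.computable_iff_re_compl_re'.2 ⟨?_, ?_⟩
    all_goals
      have h1 : Computable fun x : ℕ × ℕ => (x.2, b) :=
        Computable.pair Computable.snd (Computable.const b)
      have h2 : Computable fun x : ℕ × ℕ => (b, x.2) :=
        Computable.pair (Computable.const b) Computable.snd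
    · exact hr.to_re.and ((hr.to_re.comp_computable h1).and (hr.not.to_re.comp_computable h2))
    · refine (hr.not.to_re.or ((hr.not.to_re.comp_computable h1).or
        (hr.to_re.comp_computable h2))).of_eq fun x => ?_
      tauto
  · refine ⟨fun m n ⟨h1, h2⟩ => ?_, ⟨fun n hn => hn.2, hφ.bijOn.injOn.mono fun n hn => hn.1,
      fun o ho => ?_⟩, fun m hm n hn => ?_⟩
    · have hn := (hφ.lt_iff hb).2 h2
      have hmn := (hφ.dom _ _ h1)
      exact ⟨⟨hmn.1, ((hφ.le_iff m hmn.1 n hmn.2).1 h1).trans_lt hn.2⟩, hn⟩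
    · obtain ⟨n, hn, rfl⟩ := hφ.bijOn.surjOn (show o ∈ Iio α from lt_trans ho hβ)
      exact ⟨n, ⟨hn, ho⟩, rfl⟩
    · rw [← hφ.lt_iff hb, and_iff_left (show n ∈ D ∧ φ n < φ b from hn)]
      exact hφ.le_iff m hm.1 n hn.1

/-- Computable ordinals are countable, so `ω_ 1` is not one. This keeps the infimum defining
`omega1CK` from being that of the empty set. -/
theorem exists_not_isComputableOrdinal : ∃ α : Ordinal.{0}, ¬ IsComputableOrdinal α := by
  refine ⟨ω_ 1, ?_⟩
  rintro ⟨D, r, φ, -, h⟩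
  have hc : (Iio (ω_ 1 : Ordinal.{0})).Countable := by
    rw [← h.bijOn.image_eq]
    exact D.to_countable.image φ
  rw [← Cardinal.le_aleph0_iff_set_countable, Cardinal.mk_Iio_ordinal] at hc
  simp at hc

theorem IsComputableOrdinal.lt_omega1CK {α : Ordinal.{0}} (h : IsComputableOrdinal α) :
    α < omega1CK := by
  by_contra! hc
  exact csInf_mem (s := {α : Ordinal.{0} | ¬ IsComputableOrdinal α}) exists_not_isComputableOrdinal
    (h.of_le hc)

end Ordinals

section Difference

variable {E : Type*}

/-! ### Closure properties of uniformly `Σ⁰₁` sequences -/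

theorem uniformlySigma1_iff_mem {O X : ℕ → Set E} : UniformlySigma1 O X ↔
    ∃ W : ℕ × ℕ → Prop, REPred W ∧ ∀ n x, x ∈ X n ↔ ∃ i, W (n, i) ∧ x ∈ O i := by
  constructor
  · rintro ⟨W, hW, h⟩
    exact ⟨fun p => p ∈ W, hW, fun n x => by simp [h]⟩
  · rintro ⟨W, hW, h⟩
    exact ⟨{p | W p}, hW, fun n => by ext x; simp [h]⟩

theorem UniformlySigma1.iUnion {O A : ℕ → Set E} (hA : UniformlySigma1 O A) {R : ℕ → ℕ → Prop}
    (hR : REPred fun p : ℕ × ℕ => R p.1 p.2) :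
    UniformlySigma1 O fun n => ⋃ q ∈ {q | R n q}, A q := by
  obtain ⟨W, hW, h⟩ := uniformlySigma1_iff_mem.1 hA
  refine uniformlySigma1_iff_mem.2 ⟨fun p => ∃ q, R p.1 q ∧ W (q, p.2), ?_, fun n x => ?_⟩
  · refine REPred.exists_nat (p := fun (p : ℕ × ℕ) q => R p.1 q ∧ W (q, p.2)) (REPred.and ?_ ?_)
    · exact hR.comp_computable
        (Computable.pair (Computable.fst.comp Computable.fst) Computable.snd)
    · exact hW.comp_computable
        (Computable.pair Computable.snd (Computable.snd.comp Computable.fst))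
  · simp only [mem_iUnion, mem_ofPred_eq, h]
    constructor
    · rintro ⟨q, hq, i, hi, hx⟩
      exact ⟨i, ⟨q, hq, hi⟩, hx⟩
    · rintro ⟨i, ⟨q, hq, hi⟩, hx⟩
      exact ⟨q, hq, i, hi, hx⟩

theorem UniformlySigma1.ite {O A B : ℕ → Set E} (hA : UniformlySigma1 O A)
    (hB : UniformlySigma1 O B) {c : ℕ → Prop} [DecidablePred c] (hc : ComputablePred c)
    {f : ℕ → ℕ} (hf : Computable f) :
    UniformlySigma1 O fun n => if c n then A (f n) else B (f n) := by
  obtain ⟨V, hV, hA⟩ := uniformlySigma1_iff_mem.1 hA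
  obtain ⟨W, hW, hB⟩ := uniformlySigma1_iff_mem.1 hB
  refine uniformlySigma1_iff_mem.2
    ⟨fun p => c p.1 ∧ V (f p.1, p.2) ∨ ¬ c p.1 ∧ W (f p.1, p.2), ?_, fun n x => ?_⟩
  · have hf' : Computable fun p : ℕ × ℕ => (f p.1, p.2) :=
      Computable.pair (hf.comp Computable.fst) Computable.snd
    exact ((hc.to_re.comp_computable Computable.fst).and (hV.comp_computable hf')).or
      ((hc.not.to_re.comp_computable Computable.fst).and (hW.comp_computable hf'))
  · by_cases h : c n <;> simp [h, hA, hB]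

theorem uniformlySigma1_univ [TopologicalSpace E] {O : ℕ → Set E}
    (hO : TopologicalSpace.IsTopologicalBasis (range O)) :
    UniformlySigma1 O fun _ => univ := by
  refine uniformlySigma1_iff_mem.2
    ⟨fun _ => True, ((PrimrecPred.computablePred ⟨inferInstance, by simpa using Primrec.const true⟩)
      : ComputablePred _).to_re, fun n x => ?_⟩
  obtain ⟨_, ⟨i, rfl⟩, hx, -⟩ := hO.exists_subset_of_mem_open (mem_univ x) isOpen_univ
  simpa using ⟨i, hx⟩

/-! ### Differences along a well-order -/

theorem exists_least_rank {D : Set ℕ} (φ : ℕ → Ordinal.{0}) {A : ℕ → Set E} {x : E}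
    (h : ∃ n ∈ D, x ∈ A n) :
    ∃ n ∈ D, x ∈ A n ∧ ∀ q ∈ D, φ q < φ n → x ∉ A q := by
  obtain ⟨n, ⟨h1, h2⟩, h3⟩ :=
    (InvImage.wf φ Ordinal.lt_wf).has_min {n | n ∈ D ∧ x ∈ A n} h
  exact ⟨n, h1, h2, fun q hq hlt hx => h3 q ⟨hq, hx⟩ hlt⟩

/-- Only the least-ranked index can contribute `x`: a smaller one does not contain it, and at a
larger one it has been removed. -/
theorem mem_iUnion_diff_iff {D P : Set ℕ} {φ : ℕ → Ordinal.{0}} (hφ : InjOn φ D) (hP : P ⊆ D)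
    {A : ℕ → Set E} {x : E} {n : ℕ} (hn : n ∈ D) (hx : x ∈ A n)
    (hmin : ∀ q ∈ D, φ q < φ n → x ∉ A q) :
    x ∈ ⋃ p ∈ P, (A p \ ⋃ q ∈ {q | q ∈ D ∧ φ q < φ p}, A q) ↔ n ∈ P := by
  simp only [mem_iUnion, mem_sdiff, mem_ofPred_eq, not_exists, exists_prop, not_and]
  constructor
  · rintro ⟨p, hp, hxp, h⟩
    have h1 : φ n ≤ φ p := le_of_not_gt fun hc => hmin p (hP hp) hc hxp
    have h2 : φ p ≤ φ n := le_of_not_gt fun hc => h n ⟨hn, hc⟩ hx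
    rwa [hφ hn (hP hp) (le_antisymm h1 h2)]
  · exact fun h => ⟨n, h, hx, fun q hq => hmin q hq.1 hq.2⟩

theorem EffDUnion_subset_EffDelta2 [TopologicalSpace E] {O : ℕ → Set E}
    (hO : TopologicalSpace.IsTopologicalBasis (range O)) : EffDUnion O ⊆ EffDelta2 O := by
  intro X hX
  simp only [EffDUnion, mem_iUnion] at hX
  obtain ⟨α, -, D, r, φ, P, A, -, hφ, hr, hPdef, hP, hA, hXeq⟩ := hX
  have hPD : P ⊆ D := by rw [hPdef]; exact fun n hn => hn.1
  have hD : REPred fun n => n ∈ D := by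
    refine (hr.to_re.comp_computable (Computable.pair Computable.id Computable.id)).of_eq
      fun n => ⟨fun h => (hφ.dom _ _ h).1, fun h => (hφ.le_iff n h n h).2 le_rfl⟩
  have hEq : REPred fun p : ℕ × ℕ => p.2 = p.1 :=
    (PrimrecPred.computablePred (Primrec.eq.comp Primrec.snd Primrec.fst)).to_re
  let V : ℕ → Set E := fun n => ⋃ q ∈ {q | r q n ∧ ¬ r n q}, A q
  have hV : UniformlySigma1 O V := hA.iUnion (R := fun n q => r q n ∧ ¬ r n q)
    ((hr.to_re.comp_computable (Computable.pair Computable.snd Computable.fst)).and hr.not.to_re)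
  have hVmem : ∀ x, ∀ n ∈ D, x ∈ V n ↔ ∃ q ∈ D, φ q < φ n ∧ x ∈ A q := by
    intro x n hn
    simp only [V, mem_iUnion, mem_ofPred_eq, exists_prop, ← hφ.lt_iff hn, and_assoc]
  have hmem : ∀ x n, n ∈ D → x ∈ A n → (∀ q ∈ D, φ q < φ n → x ∉ A q) → (x ∈ X ↔ n ∈ P) := by
    intro x n hn hx hmin
    rw [hXeq]
    exact mem_iUnion_diff_iff hφ.bijOn.injOn hPD hn hx hmin
  constructor
  · refine ⟨fun n => ⋃ q ∈ {q | q = n ∧ n ∈ P}, A q, V,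
      hA.iUnion (R := fun n q => q = n ∧ n ∈ P)
        (hEq.and (hP.to_re.comp_computable Computable.fst)), hV, ?_⟩
    ext x
    rw [hXeq]
    simp only [mem_iUnion, mem_sdiff, mem_ofPred_eq, exists_prop]
    refine exists_congr fun n => ?_
    constructor
    · rintro ⟨hn, hx, h⟩
      refine ⟨⟨n, ⟨rfl, hn⟩, hx⟩, fun hc => h ?_⟩
      obtain ⟨q, h1, h2, h3⟩ := (hVmem x n (hPD hn)).1 hc
      exact ⟨q, ⟨h1, h2⟩, h3⟩
    · rintro ⟨⟨_, ⟨rfl, hn⟩, hx⟩, h⟩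
      refine ⟨hn, hx, fun ⟨q, ⟨h1, h2⟩, h3⟩ => h ?_⟩
      exact (hVmem x _ (hPD hn)).2 ⟨q, h1, h2, h3⟩
  · have hz : ComputablePred fun n : ℕ => n = 0 :=
      PrimrecPred.computablePred (Primrec.eq.comp Primrec.id (Primrec.const 0))
    have hpred : Computable Nat.pred := Primrec.pred.to_comp
    -- Index `0` contributes the points in no `A q`; index `n + 1` contributes those whose
    -- least-ranked index is `n`, for `n ∈ D` outside `P`.
    refine ⟨_, _, (uniformlySigma1_univ hO).ite (hA.iUnion (R := fun n q => q = n ∧ n ∈ D ∧ n ∉ P)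
        (hEq.and ((hD.comp_computable Computable.fst).and
          (hP.not.to_re.comp_computable Computable.fst)))) hz hpred,
      (hA.iUnion (R := fun _ q => q ∈ D) (hD.comp_computable Computable.snd)).ite hV hz hpred, ?_⟩
    ext x
    simp only [mem_iUnion, mem_sdiff, mem_compl_iff]
    constructor
    · intro hx
      by_cases hex : ∃ n ∈ D, x ∈ A n
      · obtain ⟨n, hn, hxn, hmin⟩ := exists_least_rank φ hex
        refine ⟨n + 1, ?_⟩
        simp only [Nat.add_eq_zero_iff, one_ne_zero, and_false, if_false, Nat.pred_succ,
          hVmem x n hn, mem_iUnion, mem_ofPred_eq, exists_prop]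
        exact ⟨⟨n, ⟨rfl, hn, fun h => hx ((hmem x n hn hxn hmin).2 h)⟩, hxn⟩,
          fun ⟨q, h1, h2, h3⟩ => hmin q h1 h2 h3⟩
      · exact ⟨0, by simpa using hex⟩
    · rintro ⟨_ | n, hx, hx'⟩ hxX
      · rw [hXeq] at hxX
        simp only [mem_iUnion, mem_sdiff, exists_prop] at hxX
        obtain ⟨p, hp, hxp, -⟩ := hxX
        simp only [if_true, mem_iUnion, mem_ofPred_eq, exists_prop] at hx'
        exact hx' ⟨p, hPD hp, hxp⟩
      · simp only [Nat.add_eq_zero_iff, one_ne_zero, and_false, if_false, Nat.pred_succ,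
          mem_iUnion, mem_ofPred_eq, exists_prop] at hx hx'
        obtain ⟨_, ⟨rfl, hn, hnP⟩, hxn⟩ := hx
        rw [hVmem x _ hn] at hx'
        exact hnP ((hmem x _ hn hxn fun q hq hlt hxq => hx' ⟨q, hq, hlt, hxq⟩).1 hxX)

end Difference

/-! ### Trees of finite sequences given by a local condition -/

section Tree

/-- The finite sequence `s` satisfies `step` at each position. -/
def IsPath (step : ℕ → ℕ → ℕ → Prop) (s : List ℕ) : Prop :=
  ∀ j < s.length - 1, step j (s.getD j 0) (s.getD (j + 1) 0)

variable {step : ℕ → ℕ → ℕ → Prop}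

theorem IsPath.of_append {s t : List ℕ} (h : IsPath step (s ++ t)) : IsPath step s := by
  intro j hj
  have := h j (by rw [List.length_append]; omega)
  rwa [List.getD_append _ _ _ _ (by omega), List.getD_append _ _ _ _ (by omega)] at this

theorem IsPath.append_singleton {s : List ℕ} {e : ℕ} (hs : IsPath step s)
    (he : step (s.length - 1) (s.getD (s.length - 1) 0) e) : IsPath step (s ++ [e]) := by
  intro j hj
  simp only [List.length_append, List.length_singleton, Nat.add_sub_cancel] at hj
  rcases Nat.lt_or_ge (j + 1) s.length with h | h
  · rw [List.getD_append _ _ _ _ hj, List.getD_append _ _ _ _ h]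
    exact hs j (by omega)
  · obtain rfl : j = s.length - 1 := by omega
    rw [List.getD_append _ _ _ _ hj, List.getD_append_right _ _ _ _ h]
    simpa [show s.length - 1 + 1 - s.length = 0 by omega] using he

theorem isPath_singleton (e : ℕ) : IsPath step [e] := fun j hj => by simp at hj

theorem primrecPred_isPath (hstep : PrimrecPred fun x : ℕ × ℕ × ℕ => step x.1 x.2.1 x.2.2) :
    PrimrecPred (IsPath step) := by
  have h : PrimrecRel fun (j : ℕ) (s : List ℕ) => step j (s.getD j 0) (s.getD (j + 1) 0) :=
    hstep.comp (Primrec.pair Primrec.fst (Primrec.pair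
      ((Primrec.list_getD 0).comp Primrec.snd Primrec.fst)
      ((Primrec.list_getD 0).comp Primrec.snd (Primrec.succ.comp Primrec.fst))))
  exact h.bounded_forall.comp
    (Primrec.nat_sub.comp Primrec.list_length (Primrec.const 1)) Primrec.id

/-- The list of natural numbers with the given code. -/
abbrev listOfCode (n : ℕ) : List ℕ := Denumerable.ofNat (List ℕ) n

/-- The order of the codes of finite sequences in which the codes of the sequences outside the
tree `T` come first, in their natural order, and the others follow in the Kleene–Brouwer order. -/
def treeOrder (T : List ℕ → Prop) (m n : ℕ) : Prop :=
  ¬ T (listOfCode m) ∧ T (listOfCode n) ∨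
    ¬ T (listOfCode m) ∧ ¬ T (listOfCode n) ∧ m < n ∨
    T (listOfCode m) ∧ T (listOfCode n) ∧ KleeneBrouwer (listOfCode m) (listOfCode n)

theorem isWellOrder_treeOrder {T : List ℕ → Prop}
    (hT : WellFounded fun s t => T s ∧ T t ∧ KleeneBrouwer s t) : IsWellOrder ℕ (treeOrder T) where
  wf := by
    have h1 : ∀ n, ¬ T (listOfCode n) → Acc (treeOrder T) n := by
      intro n
      induction n using Nat.strong_induction_on with
      | _ n ih =>
        intro hn
        refine ⟨_, fun m hm => ?_⟩
        rcases hm with hm | hm | hm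
        · exact (hn hm.2).elim
        · exact ih m hm.2.2 hm.1
        · exact (hn hm.2.1).elim
    refine ⟨fun n => ?_⟩
    induction n using (InvImage.wf listOfCode hT).induction with
    | _ n ih =>
      refine ⟨_, fun m hm => ?_⟩
      rcases hm with hm | hm | hm
      · exact h1 m hm.1
      · exact h1 m hm.1
      · exact ih m hm
  trichotomous := by
    intro m n h1 h2
    unfold treeOrder at h1 h2
    by_cases hm : T (listOfCode m) <;> by_cases hn : T (listOfCode n) <;>
      simp only [hm, hn, not_true_eq_false, not_false_eq_true, true_and, false_and, and_true,
        or_false, false_or, and_false] at h1 h2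
    · rcases KleeneBrouwer.trichotomy (listOfCode m) (listOfCode n) with h | h | h
      · exact (h1 h).elim
      · simpa using congrArg Encodable.encode h
      · exact (h2 h).elim
    all_goals first | exact (h1 trivial).elim | exact (h2 trivial).elim | omega

theorem primrecRel_treeOrder {T : List ℕ → Prop} (hT : PrimrecPred T) :
    PrimrecRel (treeOrder T) := by
  have h1 : PrimrecPred fun x : ℕ × ℕ => T (listOfCode x.1) :=
    hT.comp ((Primrec.ofNat (List ℕ)).comp Primrec.fst)
  have h2 : PrimrecPred fun x : ℕ × ℕ => T (listOfCode x.2) :=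
    hT.comp ((Primrec.ofNat (List ℕ)).comp Primrec.snd)
  have h3 : PrimrecPred fun x : ℕ × ℕ => KleeneBrouwer (listOfCode x.1) (listOfCode x.2) :=
    KleeneBrouwer.primrecRel.comp ((Primrec.ofNat (List ℕ)).comp Primrec.fst)
      ((Primrec.ofNat (List ℕ)).comp Primrec.snd)
  exact (h1.not.and h2).or ((h1.not.and (h2.not.and Primrec.nat_lt)).or (h1.and (h2.and h3)))

theorem omegaRank_lt {r : ℕ → ℕ → Prop} [IsWellOrder ℕ r] {m n : ℕ}
    (h : r m.unpair.1 n.unpair.1) : omegaRank r m < omegaRank r n := by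
  rw [← not_le, omegaRank, omegaRank, omega0_mul_add_natCast_le_iff, Ordinal.typein_lt_typein,
    Ordinal.typein_inj]
  rintro (h' | ⟨h', -⟩)
  · exact asymm_of r h h'
  · exact irrefl_of r _ (h' ▸ h)

theorem computablePred_omegaRank_le {r : ℕ → ℕ → Prop} (hr : PrimrecRel r) :
    ComputablePred fun p : ℕ × ℕ => r p.1.unpair.1 p.2.unpair.1 ∨
      p.1.unpair.1 = p.2.unpair.1 ∧ p.1.unpair.2 ≤ p.2.unpair.2 := by
  have h1 : Primrec fun p : ℕ × ℕ => p.1.unpair := Primrec.unpair.comp Primrec.fst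
  have h2 : Primrec fun p : ℕ × ℕ => p.2.unpair := Primrec.unpair.comp Primrec.snd
  exact ((hr.comp (Primrec.fst.comp h1) (Primrec.fst.comp h2)).or
    ((Primrec.eq.comp (Primrec.fst.comp h1) (Primrec.fst.comp h2)).and
      (Primrec.nat_le.comp (Primrec.snd.comp h1) (Primrec.snd.comp h2)))).computablePred

end Tree

/-! ### Sets that are `F_σ` and `G_δ` -/

section Main

variable {E : Type*} [TopologicalSpace E] {O : ℕ → Set E} {ll : Set E → Set E → Prop}

theorem IsApproximationRelation.exists_ll_subset {B : Set (Set E)}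
    (h : IsApproximationRelation B ll) {U V : Set E} (hU : U ∈ B) (hV : V ∈ B) {x : E}
    (hxU : x ∈ U) (hxV : x ∈ V) : ∃ W ∈ B, x ∈ W ∧ ll U W ∧ ll V W := by
  obtain ⟨T, hT, hxT, hTUV⟩ := h.isBasis.exists_subset_inter U hU V hV x ⟨hxU, hxV⟩
  obtain ⟨W, hW, hxW, hTW⟩ := h.exists_ll T hT x hxT
  exact ⟨W, hW, hxW,
    h.ll_of_subset T hT W hW U hU (hTUV.trans inter_subset_left) hTW,
    h.ll_of_subset T hT W hW V hV (hTUV.trans inter_subset_right) hTW⟩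

/-- If `(G n)` is uniformly `Σ⁰₁`, then there is a primitive recursive condition on finite sequences
of codes of basic open sets with witnesses such that the basic open sets along a sequence decrease
with respect to `≪`, and the one at position `n + 1` is contained in `G n`. -/
theorem exists_step (hE : IsEffectiveApproximationSpace O ll) {G : ℕ → Set E}
    (hG : UniformlySigma1 O G) :
    ∃ step : ℕ → ℕ → ℕ → Prop,
      (PrimrecPred fun x : ℕ × ℕ × ℕ => step x.1 x.2.1 x.2.2) ∧
      (∀ n a e, step n a e → ll (O a.unpair.1) (O e.unpair.1) ∧ O e.unpair.1 ⊆ G n) ∧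
      ∀ n a x, x ∈ O a.unpair.1 → x ∈ G n → ∃ e, step n a e ∧ x ∈ O e.unpair.1 := by
  obtain ⟨W, hW, hWG⟩ := uniformlySigma1_iff_mem.1 hG
  -- Requiring `O e` to be `≪`-below some `O w` listed for `G n` is a c.e. substitute for the
  -- inclusion in `G n`. The second component of `e` will hold the witness.
  have hre : REPred fun y : ℕ × ℕ × ℕ =>
      ll (O y.2.1) (O y.2.2) ∧ ∃ w, W (y.1, w) ∧ ll (O w) (O y.2.2) := by
    refine (hE.ce.comp_computable Computable.snd).and (REPred.exists_nat
      (p := fun (y : ℕ × ℕ × ℕ) w => W (y.1, w) ∧ ll (O w) (O y.2.2)) (REPred.and ?_ ?_))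
    · exact hW.comp_computable
        (Computable.pair (Computable.fst.comp Computable.fst) Computable.snd)
    · exact hE.ce.comp_computable (Computable.pair Computable.snd
        (Computable.snd.comp (Computable.snd.comp Computable.fst)))
  obtain ⟨q, hq, hqq⟩ := hre.exists_primrecRel
  refine ⟨fun n a e => q (n, a.unpair.1, e.unpair.1) e.unpair.2, ?_, ?_, ?_⟩
  · have ha : Primrec fun x : ℕ × ℕ × ℕ => x.2.1.unpair :=
      Primrec.unpair.comp (Primrec.fst.comp Primrec.snd)
    have he : Primrec fun x : ℕ × ℕ × ℕ => x.2.2.unpair :=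
      Primrec.unpair.comp (Primrec.snd.comp Primrec.snd)
    exact hq.comp (Primrec.pair Primrec.fst (Primrec.pair (Primrec.fst.comp ha)
      (Primrec.fst.comp he))) (Primrec.snd.comp he)
  · intro n a e h
    obtain ⟨h1, w, h2, h3⟩ := (hqq _).2 ⟨_, h⟩
    exact ⟨h1, fun x hx => (hWG n x).2 ⟨w, h2, hE.isApprox.subset_of_ll _ (mem_range_self _) _
      (mem_range_self _) h3 hx⟩⟩
  · intro n a x hxa hxG
    obtain ⟨w, hw, hxw⟩ := (hWG n x).1 hxG
    obtain ⟨_, ⟨b, rfl⟩, hxb, h1, h2⟩ := hE.isApprox.exists_ll_subset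
      (mem_range_self a.unpair.1) (mem_range_self w) hxa hxw
    obtain ⟨s, hs⟩ := (hqq (n, a.unpair.1, b)).1 ⟨h1, w, hw, h2⟩
    exact ⟨Nat.pair b s, by simpa using hs, by simpa using hxb⟩

theorem mem_EffDUnion_of_alternating (hE : IsEffectiveApproximationSpace O ll) {G : ℕ → Set E}
    (hG : UniformlySigma1 O G) (hGX : ⋂ n, G n = ∅) {X : Set E}
    (hX : ∀ x ∈ X, ∀ n, n % 2 = 0 → x ∈ G n) (hXc : ∀ x ∉ X, ∀ n, n % 2 = 1 → x ∈ G n) :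
    X ∈ EffDUnion O := by
  obtain ⟨step, hprim, hstep, hext⟩ := exists_step hE hG
  have hwf : WellFounded fun s t => IsPath step s ∧ IsPath step t ∧ KleeneBrouwer s t := by
    refine KleeneBrouwer.wellFounded_of_no_branch (fun s t => IsPath.of_append) fun f => ?_
    by_contra! hf
    have hs : ∀ n, step n (f n) (f (n + 1)) := fun n => by
      -- Length `n + 2` is the first at which position `n` has a successor.
      have := hf (n + 2) n (by simp)
      simpa [List.getD_eq_getElem?_getD] using this
    obtain ⟨x, hx⟩ := hE.isApprox.inter_nonempty (fun n => O (f n).unpair.1)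
      (fun _ => mem_range_self _) fun n => (hstep _ _ _ (hs n)).1
    have : x ∈ ⋂ n, G n := mem_iInter.2 fun n => (hstep _ _ _ (hs n)).2 (mem_iInter.1 hx (n + 1))
    rwa [hGX] at this
  have hTprim := primrecPred_isPath hprim
  let r := treeOrder (IsPath step)
  have hr : PrimrecRel r := primrecRel_treeOrder hTprim
  have : IsWellOrder ℕ r := isWellOrder_treeOrder hwf
  have hrank := isWellOrderRank_omegaRank r
  have hcomp := computablePred_omegaRank_le hr
  let s : ℕ → List ℕ := fun n => listOfCode n.unpair.1
  let last : ℕ → ℕ := fun n => ((s n).getD ((s n).length - 1) 0).unpair.1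
  -- In the copy of `ω` belonging to a node only one place carries a nonempty set of `A`: place `1`
  -- for even length, `0` for odd. As `ω * type r` is even, `P` selects the nodes of even length.
  let W : ℕ × ℕ → Prop := fun p => IsPath step (s p.1) ∧ s p.1 ≠ [] ∧
    p.1.unpair.2 = ((s p.1).length + 1) % 2 ∧ p.2 = last p.1
  have hs : Primrec s := (Primrec.ofNat (List ℕ)).comp (Primrec.fst.comp Primrec.unpair)
  have hlen : Primrec fun n => (s n).length := Primrec.list_length.comp hs
  have hlast : Primrec last := Primrec.fst.comp (Primrec.unpair.comp
    ((Primrec.list_getD 0).comp hs (Primrec.nat_sub.comp hlen (Primrec.const 1))))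
  have hW : REPred W := by
    refine PrimrecPred.computablePred ((hTprim.comp (hs.comp Primrec.fst)).and
      ((Primrec.eq.comp (hs.comp Primrec.fst) (Primrec.const [])).not.and
      ((Primrec.eq.comp (Primrec.snd.comp (Primrec.unpair.comp Primrec.fst))
        (Primrec.nat_mod.comp (Primrec.succ.comp (hlen.comp Primrec.fst)) (Primrec.const 2))).and
      (Primrec.eq.comp Primrec.snd (hlast.comp Primrec.fst))))) |>.to_re
  let A : ℕ → Set E := fun n => {x | ∃ i, W (n, i) ∧ x ∈ O i}
  have hA : UniformlySigma1 O A := uniformlySigma1_iff_mem.2 ⟨W, hW, fun n x => Iff.rfl⟩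
  have hαpos : 0 < Ordinal.omega0 * Ordinal.type r :=
    mul_pos Ordinal.omega0_pos (pos_iff_ne_zero.2 (Ordinal.type_ne_zero_of_nonempty r))
  let P : Set ℕ := {n | n ∈ univ ∧ ¬ SameParity (omegaRank r n) (Ordinal.omega0 * Ordinal.type r)}
  have hPmem : ∀ n, n ∈ P ↔ n.unpair.2 % 2 = 1 := by
    intro n
    change (n ∈ univ ∧ ¬ _) ↔ _
    rw [SameParity, omega0_mul_mod_two, omegaRank, omega0_mul_add_natCast_mod_two]
    simp only [mem_univ, true_and, Nat.cast_eq_zero]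
    omega
  have hP : ComputablePred fun n => n ∈ P := by
    have : PrimrecPred fun n : ℕ => n.unpair.2 % 2 = 1 :=
      Primrec.eq.comp (Primrec.nat_mod.comp (Primrec.snd.comp Primrec.unpair) (Primrec.const 2))
        (Primrec.const 1)
    exact this.computablePred.of_eq fun n => (hPmem n).symm
  simp only [EffDUnion, mem_iUnion]
  refine ⟨_, ⟨Order.one_le_iff_pos.2 hαpos,
    IsComputableOrdinal.lt_omega1CK ⟨_, _, _, hcomp, hrank⟩⟩,
    univ, _, _, P, A, Or.inl rfl, hrank, hcomp, rfl, hP, hA, ?_⟩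
  ext x
  have hex : ∃ n ∈ (univ : Set ℕ), x ∈ A n := by
    obtain ⟨_, ⟨i, rfl⟩, hxi, -⟩ :=
      hE.isApprox.isBasis.exists_subset_of_mem_open (mem_univ x) isOpen_univ
    -- A one-term node carries no constraint, so any basic open set around `x` serves.
    exact ⟨Nat.pair (Encodable.encode [Nat.pair i 0]) 0, mem_univ _, i,
      by simp [W, s, last, isPath_singleton], hxi⟩
  obtain ⟨n, hn, hxA, hmin⟩ := exists_least_rank (omegaRank r) hex
  rw [mem_iUnion_diff_iff hrank.bijOn.injOn (fun _ h => h.1) hn hxA hmin, hPmem]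
  obtain ⟨i, ⟨hpath, hne, hpar, hi⟩, hxi⟩ := hxA
  dsimp only at hpath hne hpar hi
  -- Otherwise the node extends by a set containing `x`, and a proper extension precedes it in the
  -- Kleene–Brouwer order, against minimality.
  have hnotin : x ∉ G ((s n).length - 1) := by
    intro hxG
    obtain ⟨e, he, hxe⟩ := hext _ ((s n).getD ((s n).length - 1) 0) x (by subst hi; exact hxi) hxG
    have hpath' := hpath.append_singleton he
    refine hmin (Nat.pair (Encodable.encode (s n ++ [e])) (((s n).length + 2) % 2)) (mem_univ _)
      (omegaRank_lt (Or.inr (Or.inr ?_))) ⟨e.unpair.1, ?_, hxe⟩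
    · simp only [Nat.unpair_pair, listOfCode, Denumerable.ofNat_encode]
      exact ⟨hpath', hpath, KleeneBrouwer.append_singleton _ _⟩
    · have hs' : s (Nat.pair (Encodable.encode (s n ++ [e])) (((s n).length + 2) % 2)) =
          s n ++ [e] := by
        change listOfCode _ = _
        simp only [Nat.unpair_pair, listOfCode, Denumerable.ofNat_encode]
      simp only [W, last, hs']
      exact ⟨hpath', by simp, by simp; omega, by simp⟩
  have hlenpos := List.length_pos_of_ne_nil hne
  constructor
  · intro hx
    by_contra h
    exact hnotin (hX x hx _ (by omega))
  · intro h
    by_contra hx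
    exact hnotin (hXc x hx _ (by omega))

theorem EffFsigma_inter_EffGdelta_subset (hE : IsEffectiveApproximationSpace O ll) :
    EffFsigma O ∩ EffGdelta O ⊆ EffDUnion O := by
  rintro X ⟨⟨C, hC, hXC⟩, U, hU, hXU⟩
  have hc : ComputablePred fun n : ℕ => n % 2 = 0 := PrimrecPred.computablePred
    (Primrec.eq.comp (Primrec.nat_mod.comp Primrec.id (Primrec.const 2)) (Primrec.const 0))
  have hf : Computable fun n : ℕ => n / 2 :=
    (Primrec.nat_div.comp Primrec.id (Primrec.const 2)).to_comp
  -- Even terms are the `U n`, odd terms the complements of the `C n`.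
  refine mem_EffDUnion_of_alternating hE (hU.ite hC hc hf) ?_ ?_ ?_
  · refine eq_empty_iff_forall_notMem.2 fun x hx => ?_
    rw [mem_iInter] at hx
    have h1 : x ∈ X := by
      rw [hXU, mem_iInter]
      intro n
      simpa using hx (2 * n)
    rw [hXC, mem_iUnion] at h1
    obtain ⟨n, hn⟩ := h1
    have h2 := hx (2 * n + 1)
    rw [if_neg (by omega), show (2 * n + 1) / 2 = n by omega] at h2
    exact h2 hn
  · intro x hx n hn
    rw [if_pos hn]
    rw [hXU, mem_iInter] at hx
    exact hx _
  · intro x hx n hn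
    rw [if_neg (by omega)]
    rw [hXC, mem_iUnion, not_exists] at hx
    exact hx _

end Main

end EffHausdorff

theorem theorem5p9 {E : Type*} [TopologicalSpace E] (O : ℕ → Set E) (ll : Set E → Set E → Prop)
    (hE : EffHausdorff.IsEffectiveApproximationSpace O ll) :
    EffHausdorff.EffFsigma O ∩ EffHausdorff.EffGdelta O ⊆ EffHausdorff.EffDUnion O ∧
    EffHausdorff.EffDUnion O ⊆ EffHausdorff.EffDelta2 O ∧
    (EffHausdorff.EffFsigma O ∩ EffHausdorff.EffGdelta O = EffHausdorff.EffDelta2 O →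
      EffHausdorff.EffDUnion O = EffHausdorff.EffDelta2 O) := by
  have h1 := EffHausdorff.EffFsigma_inter_EffGdelta_subset hE
  have h2 := EffHausdorff.EffDUnion_subset_EffDelta2 hE.isApprox.isBasis
  exact ⟨h1, h2, fun h => h2.antisymm (h ▸ h1)⟩
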